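/- All graphs are finite, simple, undirected and connected. Let $G=(V,E)$ be such a graph, of order $n=|V|$, with distance function $d$ and diameter $D=\max_{u,v\in V}d(u,v)$, and write $N(v)$ for the set of neighbours of a vertex $v$. A set $S\subseteq V$ is *dominating* if $N(v)\cap S\neq\emptyset$ for every $v\in V\setminus S$; it is *locating* if for every two distinct vertices $u,v\in V$ there is $x\in S$ with $d(u,x)\neq d(v,x)$; it is *metric-locating-dominating* if it is both dominating and locating; and it is *locating-dominating* if it is dominating and $N(u)\cap S\neq N(v)\cap S$ for every two distinct vertices $u,v\in V\setminus S$. Let $\beta(G)$ (the metric dimension), $\eta(G)$ and $\lambda(G)$ denote the minimum cardinality of, respectively, a locating set, a metric-locating-dominating set and a locating-dominating set of $G$. **Proposition.** If $D=2$ or $\beta(G)\ge n-3$, then $\eta(G)=\lambda(G)$. -/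

import Mathlib

namespace SimpleGraph

variable {V : Type*}

/-- The vector of metric coordinates of the vertex `v` with respect to the set `S`, indexed by
the elements of `S`. -/
noncomputable def metricCoord (G : SimpleGraph V) (S : Finset V) (v : V) : S → ℕ :=
  fun x => G.dist v x

/-- `S` is dominating: every vertex outside `S` has a neighbour in `S`. -/
def IsDominatingSet (G : SimpleGraph V) (S : Finset V) : Prop :=
  ∀ v, v ∉ S → (G.neighborSet v ∩ (S : Set V)).Nonempty

/-- `S` is locating: distinct vertices have distinct vectors of metric coordinates. -/
def IsLocatingSet (G : SimpleGraph V) (S : Finset V) : Prop :=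
  ∀ u v, u ≠ v → G.metricCoord S u ≠ G.metricCoord S v

/-- `S` is metric-locating-dominating: it is both dominating and locating. -/
def IsMetricLocatingDominatingSet (G : SimpleGraph V) (S : Finset V) : Prop :=
  G.IsDominatingSet S ∧ G.IsLocatingSet S

/-- `S` is locating-dominating: the vertices outside `S` have nonempty and pairwise distinct
neighbourhoods in `S`. -/
def IsLocatingDominatingSet (G : SimpleGraph V) (S : Finset V) : Prop :=
  (∀ v, v ∉ S → (G.neighborSet v ∩ (S : Set V)).Nonempty) ∧
    ∀ u v, u ∉ S → v ∉ S → u ≠ v →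
      G.neighborSet u ∩ (S : Set V) ≠ G.neighborSet v ∩ (S : Set V)

/-- The metric dimension `β(G)`: the minimum cardinality of a locating set. -/
noncomputable def metricDimension (G : SimpleGraph V) : ℕ :=
  sInf {k | ∃ S : Finset V, G.IsLocatingSet S ∧ S.card = k}

/-- The metric-location-domination number `η(G)`: the minimum cardinality of a
metric-locating-dominating set. -/
noncomputable def metricLocationDominationNumber (G : SimpleGraph V) : ℕ :=
  sInf {k | ∃ S : Finset V, G.IsMetricLocatingDominatingSet S ∧ S.card = k}

/-- The location-domination number `λ(G)`: the minimum cardinality of a locating-dominating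
set. -/
noncomputable def locationDominationNumber (G : SimpleGraph V) : ℕ :=
  sInf {k | ∃ S : Finset V, G.IsLocatingDominatingSet S ∧ S.card = k}

/-- In a finite connected graph the whole vertex set has all the properties above, so the three
minima are taken over nonempty sets. -/
theorem univ_isLocatingSet_and_others [Fintype V] {G : SimpleGraph V} (hG : G.Connected) :
    G.IsLocatingSet Finset.univ ∧ G.IsMetricLocatingDominatingSet Finset.univ ∧
      G.IsLocatingDominatingSet Finset.univ := by
  have h : G.IsLocatingSet Finset.univ := by
    intro u v huv he
    have h1 := congrFun he ⟨u, Finset.mem_univ u⟩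
    simp only [metricCoord, SimpleGraph.dist_self] at h1
    exact huv (hG.dist_eq_zero_iff.mp h1.symm).symm
  refine ⟨h, ⟨fun v hv => absurd (Finset.mem_univ v) hv, h⟩,
    fun v hv => absurd (Finset.mem_univ v) hv, fun u _ hu => absurd (Finset.mem_univ u) hu⟩

end SimpleGraph

namespace SimpleGraph

variable {V : Type*} {G : SimpleGraph V} {S : Finset V}

/-! Distances 0 and 1 record equality and adjacency, so η ≤ λ always. For the converse, if D = 2
adjacency determines every distance from outside S to S. If β ≥ n - 3, a metric-locating-dominating
S omits at most three vertices, and any failure to be locating-dominating is repaired by swapping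
the first two inner vertices of a geodesic. -/

theorem Adj.dist_le_dist_add_one (hG : G.Connected) {x z : V} (h : G.Adj x z) (s : V) :
    G.dist x s ≤ G.dist z s + 1 := by
  have h1 : G.dist x s ≤ G.dist x z + G.dist z s := hG.dist_triangle
  rw [dist_eq_one_iff_adj.mpr h] at h1
  omega

/-- A first step of a geodesic: a vertex `x ≠ s` has a neighbour that is closer to `s`. -/
theorem Connected.exists_adj_dist_add_one_eq (hG : G.Connected) {x s : V} (h : x ≠ s) :
    ∃ z, G.Adj x z ∧ G.dist z s + 1 = G.dist x s := by
  obtain ⟨p, hp⟩ := hG.exists_walk_length_eq_dist x s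
  cases p with
  | nil => exact absurd rfl h
  | cons hxz q =>
    refine ⟨_, hxz, le_antisymm ?_ ?_⟩
    · rw [← hp, Walk.length_cons]
      exact Nat.succ_le_succ (dist_le q)
    · exact hxz.dist_le_dist_add_one hG s

theorem IsLocatingSet.exists_dist_ne (hS : G.IsLocatingSet S) {u v : V} (h : u ≠ v) :
    ∃ s ∈ S, G.dist u s ≠ G.dist v s := by
  obtain ⟨s, hs⟩ := Function.ne_iff.mp (hS u v h)
  exact ⟨s, s.2, hs⟩

theorem adj_iff_of_neighborSet_inter_eq {u v a : V}
    (h : G.neighborSet u ∩ (S : Set V) = G.neighborSet v ∩ (S : Set V)) (ha : a ∈ S) :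
    G.Adj u a ↔ G.Adj v a := by
  simpa [ha] using Set.ext_iff.mp h a

theorem IsLocatingDominatingSet.isMetricLocatingDominatingSet (hG : G.Connected)
    (hS : G.IsLocatingDominatingSet S) : G.IsMetricLocatingDominatingSet S := by
  refine ⟨hS.1, fun u v huv he => ?_⟩
  have hd : ∀ s ∈ S, G.dist u s = G.dist v s := fun s hs => congrFun he ⟨s, hs⟩
  have hu : u ∉ S := fun hu => by
    have := hd u hu
    rw [dist_self] at this
    exact huv (hG.dist_eq_zero_iff.mp this.symm).symm
  have hv : v ∉ S := fun hv => by
    have := hd v hv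
    rw [dist_self] at this
    exact huv (hG.dist_eq_zero_iff.mp this)
  refine hS.2 u v hu hv huv (Set.ext fun s => and_congr_left fun hs => ?_)
  rw [mem_neighborSet, mem_neighborSet, ← dist_eq_one_iff_adj, ← dist_eq_one_iff_adj, hd s hs]

/-- In a connected graph in which all distances are at most two, metric-locating-dominating sets
are locating-dominating. -/
theorem IsMetricLocatingDominatingSet.isLocatingDominatingSet (hG : G.Connected)
    (hD : ∀ u v, G.dist u v ≤ 2) (hS : G.IsMetricLocatingDominatingSet S) :
    G.IsLocatingDominatingSet S := by
  refine ⟨hS.1, fun u v hu hv huv he => ?_⟩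
  obtain ⟨s, hs, hne⟩ := hS.2.exists_dist_ne huv
  have hus : G.dist u s ≠ 0 := fun h => hu (hG.dist_eq_zero_iff.mp h ▸ hs)
  have hvs : G.dist v s ≠ 0 := fun h => hv (hG.dist_eq_zero_iff.mp h ▸ hs)
  have h1 := adj_iff_of_neighborSet_inter_eq he hs
  rw [← dist_eq_one_iff_adj, ← dist_eq_one_iff_adj] at h1
  have h2 := hD u s
  have h3 := hD v s
  omega

/-- If `S` is dominating with at most three vertices outside, two of which have the same
neighbours in `S` but different distances to a vertex of `S`, then exchanging one vertex turns `S`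
into a locating-dominating set. -/
theorem IsDominatingSet.exists_isLocatingDominatingSet_of_dist_lt [Fintype V] [DecidableEq V]
    (hG : G.Connected) (hS : G.IsDominatingSet S) (hcard : Sᶜ.card ≤ 3) {x y s : V}
    (hx : x ∉ S) (hy : y ∉ S) (hs : s ∈ S)
    (he : G.neighborSet x ∩ (S : Set V) = G.neighborSet y ∩ (S : Set V))
    (hlt : G.dist x s < G.dist y s) :
    ∃ S' : Finset V, G.IsLocatingDominatingSet S' ∧ S'.card = S.card := by
  have hxy : x ≠ y := by rintro rfl; exact lt_irrefl _ hlt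
  obtain ⟨z, hxz, hz⟩ := hG.exists_adj_dist_add_one_eq (x := x) (s := s) (by rintro rfl; exact hx hs)
  have hyz : ¬ G.Adj y z := fun h => by
    have := h.dist_le_dist_add_one hG s
    omega
  -- Since x and y have the same neighbours in S, z must be the third and last vertex outside S; the
  -- next geodesic vertex w then lies in S.
  have hzS : z ∉ S := fun h => hyz ((adj_iff_of_neighborSet_inter_eq he h).mp hxz)
  obtain ⟨w, hzw, hw⟩ := hG.exists_adj_dist_add_one_eq (x := z) (s := s)
    (by rintro rfl; exact hzS hs)
  have hzx : z ≠ x := hxz.ne'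
  have hzy : z ≠ y := by rintro rfl; omega
  have hwx : w ≠ x := by rintro rfl; omega
  have hwy : w ≠ y := by rintro rfl; omega
  have hcompl : ({x, y, z} : Finset V) = Sᶜ := by
    refine Finset.eq_of_subset_of_card_le ?_ ?_
    · simp [Finset.insert_subset_iff, hx, hy, hzS]
    · rwa [Finset.card_eq_three.mpr ⟨x, y, z, hxy, hzx.symm, hzy.symm, rfl⟩]
  have hmem : ∀ v, v ∉ S → v = x ∨ v = y ∨ v = z := fun v hv => by
    have : v ∈ ({x, y, z} : Finset V) := hcompl ▸ Finset.mem_compl.mpr hv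
    simpa using this
  have hwS : w ∈ S := by
    by_contra h
    rcases hmem w h with h | h | h
    exacts [hwx h, hwy h, hzw.ne' h]
  obtain ⟨u, hyu, huS⟩ := hS y hy
  rw [mem_neighborSet] at hyu
  have huS : u ∈ S := huS
  have hxu : G.Adj x u := (adj_iff_of_neighborSet_inter_eq he huS).mpr hyu
  -- Here d(y,s) ≥ d(x,s) + 1 = d(w,s) + 3, too far for a path y, u, w.
  have hwu : ¬ G.Adj w u := fun h => by
    have h1 := hyu.dist_le_dist_add_one hG s
    have h2 := h.symm.dist_le_dist_add_one hG s
    omega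
  have huw : u ≠ w := by
    rintro rfl
    have := hyu.dist_le_dist_add_one hG s
    omega
  have hS' : ∀ v, v ∉ insert z (S.erase w) → v = x ∨ v = y ∨ v = w := fun v hv => by
    simp only [Finset.mem_insert, Finset.mem_erase, not_or, not_and] at hv
    by_cases hvw : v = w
    · exact Or.inr (Or.inr hvw)
    · rcases hmem v (hv.2 hvw) with h | h | h
      exacts [Or.inl h, Or.inr (Or.inl h), absurd h hv.1]
  have huS' : u ∈ insert z (S.erase w) := by simp [huw, huS]
  have hzS' : z ∈ insert z (S.erase w) := Finset.mem_insert_self _ _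
  -- Now x, y, w are outside: u dominates x and y and separates them from w, while z dominates w and
  -- separates x from y.
  refine ⟨insert z (S.erase w), ⟨fun v hv => ?_, fun a b ha hb hab h => ?_⟩, ?_⟩
  · rcases hS' v hv with rfl | rfl | rfl
    exacts [⟨u, hxu, huS'⟩, ⟨u, hyu, huS'⟩, ⟨z, hzw.symm, hzS'⟩]
  · have h1 := adj_iff_of_neighborSet_inter_eq h huS'
    have h2 := adj_iff_of_neighborSet_inter_eq h hzS'
    have hwz := hzw.symm
    rcases hS' a ha with rfl | rfl | rfl <;> rcases hS' b hb with rfl | rfl | rfl <;> tauto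
  · rw [Finset.card_insert_of_notMem (fun h => hzS (Finset.mem_of_mem_erase h)),
      Finset.card_erase_add_one hwS]

theorem IsMetricLocatingDominatingSet.exists_isLocatingDominatingSet [Fintype V] [DecidableEq V]
    (hG : G.Connected) (hS : G.IsMetricLocatingDominatingSet S) (hcard : Sᶜ.card ≤ 3) :
    ∃ S' : Finset V, G.IsLocatingDominatingSet S' ∧ S'.card = S.card := by
  by_cases hex : ∃ u v, u ∉ S ∧ v ∉ S ∧ u ≠ v ∧
      G.neighborSet u ∩ (S : Set V) = G.neighborSet v ∩ (S : Set V)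
  · obtain ⟨u, v, hu, hv, huv, he⟩ := hex
    obtain ⟨s, hs, hne⟩ := hS.2.exists_dist_ne huv
    rcases hne.lt_or_gt with hlt | hlt
    · exact hS.1.exists_isLocatingDominatingSet_of_dist_lt hG hcard hu hv hs he hlt
    · exact hS.1.exists_isLocatingDominatingSet_of_dist_lt hG hcard hv hu hs he.symm hlt
  · exact ⟨S, ⟨hS.1, fun u v hu hv huv he => hex ⟨u, v, hu, hv, huv, he⟩⟩, rfl⟩

end SimpleGraph

theorem mainTheorem9 {V : Type*} [Fintype V] (G : SimpleGraph V) (hG : G.Connected)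
    (h : G.diam = 2 ∨ (Fintype.card V : ℤ) - 3 ≤ (G.metricDimension : ℤ)) :
    G.metricLocationDominationNumber = G.locationDominationNumber := by
  classical
  obtain ⟨-, hM, hL⟩ := SimpleGraph.univ_isLocatingSet_and_others hG
  apply le_antisymm
  · obtain ⟨S, hS, hc⟩ : G.locationDominationNumber ∈ _ := Nat.sInf_mem ⟨_, _, hL, rfl⟩
    rw [← hc]
    exact Nat.sInf_le ⟨S, hS.isMetricLocatingDominatingSet hG, rfl⟩
  · obtain ⟨S, hS, hc⟩ : G.metricLocationDominationNumber ∈ _ := Nat.sInf_mem ⟨_, _, hM, rfl⟩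
    rw [← hc]
    rcases h with h | h
    · refine Nat.sInf_le ⟨S, hS.isLocatingDominatingSet hG fun u v => ?_, rfl⟩
      rw [← h]
      have := hG.nonempty
      exact SimpleGraph.dist_le_diam (SimpleGraph.connected_iff_ediam_ne_top.mp hG)
    · have hle : G.metricDimension ≤ S.card := Nat.sInf_le ⟨S, hS.2, rfl⟩
      -- S is locating, so |S| ≥ β ≥ n - 3.
      obtain ⟨S', hS', hc'⟩ := hS.exists_isLocatingDominatingSet hG (by
        have := S.card_add_card_compl
        omega)
      exact Nat.sInf_le ⟨S', hS', hc'⟩
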